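/- Let $G$ be a compact Hausdorff topological group with a countable basis, and let $\mu=(\mu_k)_{k\in-\mathbb N}$, $-\mathbb N=\{0,-1,-2,\dots\}$, be a family of Borel probability measures on $G$. A \emph{solution} (with noise law $\mu$) is a pair of $G$-valued processes $\{(\eta_k)_{k\in-\mathbb N},(\xi_k)_{k\in-\mathbb N}\}$ on a common probability space such that, for every $k\in-\mathbb N$, $\eta_k=\xi_k\eta_{k-1}$ almost surely, $\xi_k$ is independent of $\sigma(\eta_m:m\le k-1)$, and $\xi_k$ has law $\mu_k$. Let $\mathscr P_\mu$ be the set of the laws on $G^{-\mathbb N}$ of $(\eta_k)$ for all solutions; it is a convex set of probability measures. A solution is \emph{extremal} if the law of $(\eta_k)$ is an extreme point of $\mathscr P_\mu$. For a solution $\{(\eta^0_k),(\xi_k)\}$, a deterministic sequence $(\alpha_l)_{l\in-\mathbb N}$ in $G$ and a compact subgroup $H$ of $G$, consider the following conditions, where $G/H$ is the space of left cosets $gH$ with the quotient topology and all limits are taken as $l\to-\infty$: (E1) for each $k\in-\mathbb N$, $\xi_k\xi_{k-1}\cdots\xi_l\,\alpha_l\to\eta^0_k$ in distribution; (E2) $\alpha_l^{-1}\eta^0_{l-1}\to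 U_H$ in distribution, where the law of $U_H$ is the normalized Haar measure of $H$; (E3) for each $h\in H$ and each $k\in-\mathbb N$, $\eta^0_kh$ and $\eta^0_k$ have the same law; (E4) for each $k\in-\mathbb N$, $\xi_k\xi_{k-1}\cdots\xi_l\,\alpha_lH\to\eta^0_kH$ almost surely in $G/H$. Then the following statements hold. (i) If a solution $\{(\eta^0_k),(\xi_k)\}$ satisfies (E1) with some sequence $(\alpha_l)$, then it is extremal. (ii) If a solution $\{(\eta^0_k),(\xi_k)\}$ satisfies (E1), (E3) and (E4) for some $(\alpha_l)$ and some compact subgroup $H$, then it also satisfies (E2) with the same $(\alpha_l)$ and $H$. -/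

import Mathlib

open MeasureTheory ProbabilityTheory Filter Topology
open scoped NNReal

/-! A process indexed by the non-positive integers `0, -1, -2, …` is written as a sequence
indexed by `ℕ`: the value at the index `n : ℕ` is the value at time `-n`.  Thus time `k - 1`
is the index `k + 1`, and `l → -∞` is `atTop` on `ℕ`. -/

namespace StochEq

universe u v

/-- The σ-field generated by the values of `η` up to time `-k`. -/
abbrev pastField {G : Type u} [MeasurableSpace G] {Ω : Type v} (η : ℕ → Ω → G) (k : ℕ) :
    MeasurableSpace Ω :=
  ⨆ m : ℕ, ⨆ _ : k ≤ m, MeasurableSpace.comap (η m) inferInstance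

/-- The pair of processes `(η, ξ)` on `(Ω, P)` is a solution of `η_k = ξ_k η_{k-1}` with noise
law `μ`. -/
structure IsSolution {G : Type u} [Group G] [MeasurableSpace G]
    {Ω : Type v} [MeasurableSpace Ω] (P : Measure Ω) (μ : ℕ → ProbabilityMeasure G)
    (η ξ : ℕ → Ω → G) : Prop where
  measurable_eta : ∀ k, Measurable (η k)
  measurable_xi : ∀ k, Measurable (ξ k)
  equation : ∀ k, ∀ᵐ ω ∂P, η k ω = ξ k ω * η (k + 1) ω
  indep : ∀ k, Indep (MeasurableSpace.comap (ξ k) inferInstance) (pastField η (k + 1)) P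
  noise_law : ∀ k, P.map (ξ k) = (μ k : Measure G)

/-- The law of the process `η` on the sequence space. -/
noncomputable def pathLaw {G : Type u} [MeasurableSpace G] {Ω : Type v} [MeasurableSpace Ω]
    (P : Measure Ω) (η : ℕ → Ω → G) : Measure (ℕ → G) :=
  P.map (fun ω k => η k ω)

/-- The set of the laws of `η` for all solutions `(η, ξ)` with noise law `μ`, on all probability
spaces.  The universe of the probability spaces is immaterial; see `pathLaw_mem_solutionLaws`. -/
def solutionLaws {G : Type u} [Group G] [MeasurableSpace G] (μ : ℕ → ProbabilityMeasure G) :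
    Set (Measure (ℕ → G)) :=
  {Q | ∃ (Ω : Type u) (_ : MeasurableSpace Ω) (P : Measure Ω) (_ : IsProbabilityMeasure P)
      (η ξ : ℕ → Ω → G), IsSolution P μ η ξ ∧ pathLaw P η = Q}

/-- The solution with first component `η` is extremal: the law of `η` is an extreme point of the
set of solution laws, for the usual convex structure (mixtures `a • Q₁ + b • Q₂`). -/
def IsExtremal {G : Type u} [Group G] [MeasurableSpace G] {Ω : Type v} [MeasurableSpace Ω]
    (P : Measure Ω) (μ : ℕ → ProbabilityMeasure G) (η : ℕ → Ω → G) : Prop :=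
  pathLaw P η ∈ Set.extremePoints ℝ≥0 (solutionLaws μ)

/-- `ξ_k ξ_{k-1} ⋯ ξ_l`, where the indices `k ≤ l` in `ℕ` stand for the times `-k ≥ -l`. -/
def noiseProd {G : Type u} [Group G] {Ω : Type v} (ξ : ℕ → Ω → G) (k l : ℕ) (ω : Ω) : G :=
  ((List.Ico k (l + 1)).map (fun i => ξ i ω)).prod

/-- `ξ_k ξ_{k-1} ⋯ ξ_l α_l → η_k` in law as `l → -∞`, for each `k`. -/
def CondE1 {G : Type u} [Group G] [TopologicalSpace G] [MeasurableSpace G] [BorelSpace G]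
    {Ω : Type v} [MeasurableSpace Ω] (P : Measure Ω) [IsProbabilityMeasure P]
    (η ξ : ℕ → Ω → G) (α : ℕ → G) : Prop :=
  ∀ k, TendstoInDistribution (fun l ω => noiseProd ξ k l ω * α l) atTop (η k) (fun _ => P) P

/-- The normalized Haar measure of a compact group. -/
noncomputable def normalizedHaar (K : Type u) [Group K] [TopologicalSpace K]
    [IsTopologicalGroup K] [CompactSpace K] [MeasurableSpace K] [BorelSpace K] : Measure K :=
  Measure.haarMeasure (⊤ : TopologicalSpace.PositiveCompacts K)

instance isProbabilityMeasure_normalizedHaar (K : Type u) [Group K] [TopologicalSpace K]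
    [IsTopologicalGroup K] [CompactSpace K] [MeasurableSpace K] [BorelSpace K] :
    IsProbabilityMeasure (normalizedHaar K) :=
  ⟨by
    have h := Measure.haarMeasure_self (K₀ := (⊤ : TopologicalSpace.PositiveCompacts K))
    rwa [TopologicalSpace.PositiveCompacts.coe_top] at h⟩

/-- `α_l⁻¹ η_{l-1} → U_H` in law as `l → -∞`.  The limit `U_H` is realized as the inclusion of
`H` in `G` on the probability space `H` with its normalized Haar measure. -/
def CondE2 {G : Type u} [Group G] [TopologicalSpace G] [IsTopologicalGroup G]
    [MeasurableSpace G] [BorelSpace G]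
    {Ω : Type v} [MeasurableSpace Ω] (P : Measure Ω) [IsProbabilityMeasure P]
    (η : ℕ → Ω → G) (α : ℕ → G) (H : Subgroup G) [CompactSpace H] : Prop :=
  TendstoInDistribution (fun l ω => (α l)⁻¹ * η (l + 1) ω) atTop
    (fun h : H => (h : G)) (fun _ => P) (normalizedHaar H)

/-- `η_k h` and `η_k` have the same law, for each `h ∈ H` and each `k`. -/
def CondE3 {G : Type u} [Group G] [MeasurableSpace G]
    {Ω : Type v} [MeasurableSpace Ω] (P : Measure Ω)
    (η : ℕ → Ω → G) (H : Subgroup G) : Prop :=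
  ∀ h ∈ H, ∀ k, P.map (fun ω => η k ω * h) = P.map (η k)

/-- `ξ_k ξ_{k-1} ⋯ ξ_l α_l H → η_k H` almost surely in `G ⧸ H` (the space of left cosets `gH`
with the quotient topology) as `l → -∞`, for each `k`. -/
def CondE4 {G : Type u} [Group G] [TopologicalSpace G]
    {Ω : Type v} [MeasurableSpace Ω] (P : Measure Ω)
    (η ξ : ℕ → Ω → G) (α : ℕ → G) (H : Subgroup G) : Prop :=
  ∀ k, ∀ᵐ ω ∂P, Tendsto (fun l => ((noiseProd ξ k l ω * α l : G) : G ⧸ H)) atTop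
    (𝓝 ((η k ω : G) : G ⧸ H))

/-- The law of every solution, on a probability space in any universe, is a solution law. -/
theorem pathLaw_mem_solutionLaws {G : Type u} [Group G] [MeasurableSpace G] [MeasurableEq G]
    [MeasurableMul₂ G]
    {Ω : Type v} [MeasurableSpace Ω] (P : Measure Ω) [IsProbabilityMeasure P]
    (μ : ℕ → ProbabilityMeasure G) (η ξ : ℕ → Ω → G) (h : IsSolution P μ η ξ) :
    pathLaw P η ∈ solutionLaws μ := by
  have hm : Measurable (fun ω => ((fun k => η k ω, fun k => ξ k ω) : (ℕ → G) × (ℕ → G))) :=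
    (measurable_pi_lambda _ h.measurable_eta).prodMk (measurable_pi_lambda _ h.measurable_xi)
  have e1 : ∀ k, Measurable (fun p : (ℕ → G) × (ℕ → G) => p.1 k) := fun k => by fun_prop
  have e2 : ∀ k, Measurable (fun p : (ℕ → G) × (ℕ → G) => p.2 k) := fun k => by fun_prop
  refine ⟨(ℕ → G) × (ℕ → G), inferInstance, P.map _, Measure.isProbabilityMeasure_map hm.aemeasurable,
    fun k p => p.1 k, fun k p => p.2 k, ⟨e1, e2, fun k => ?_, fun k => ?_, fun k => ?_⟩, ?_⟩
  · exact (ae_map_iff hm.aemeasurable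
      (measurableSet_eq_fun (e1 k) ((e2 k).mul (e1 (k + 1))))).2 (h.equation k)
  · have hpast : pastField (fun (k : ℕ) (p : (ℕ → G) × (ℕ → G)) => p.1 k) (k + 1) ≤
        (inferInstance : MeasurableSpace ((ℕ → G) × (ℕ → G))) :=
      iSup₂_le fun m _ => (e1 m).comap_le
    rw [Indep_iff]
    intro s t hs ht
    have hs' := (e2 k).comap_le s hs
    have ht' := hpast t ht
    rw [Measure.map_apply hm (hs'.inter ht'), Measure.map_apply hm hs', Measure.map_apply hm ht']
    refine (Indep_iff _ _ _).1 (h.indep k) _ _ ?_ ?_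
    · obtain ⟨A, hA, rfl⟩ := hs
      exact ⟨A, hA, rfl⟩
    · have : pastField η (k + 1) = (pastField (fun (k : ℕ) (p : (ℕ → G) × (ℕ → G)) => p.1 k)
          (k + 1)).comap (fun ω => (fun k => η k ω, fun k => ξ k ω)) := by
        simp only [pastField, MeasurableSpace.comap_iSup, MeasurableSpace.comap_comp]
        rfl
      rw [this]
      exact ⟨t, ht, rfl⟩
  · rw [Measure.map_map (e2 k) hm]
    exact h.noise_law k
  · rw [pathLaw, Measure.map_map (measurable_pi_lambda _ e1) hm]
    rfl

end StochEq

/-!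
(i) The product `ξ_k ⋯ ξ_l` has the same law for every solution, and applied to time `l - 1` it
transports any solution to its value at time `k`. Inserting `α_l α_l⁻¹` and passing to a limit
point `V` of the laws of `α_l⁻¹ η'_{l-1}`, (E1) shows that the marginals of any solution `η'` are
`ν_k * V`, where `ν_k` is the law of `η⁰_k`. If `η⁰` is a mixture of two solutions, with limit
points `V₁` and `V₂`, then `ν_k` is invariant under right convolution with the mixture `W` of
`V₁` and `V₂`. For continuous `f` the function `g ↦ ∫ f(xg) dν_k(x)` is then `W`-harmonic, hence
invariant under `W`-almost every translation, so that `ν_k * V₁ = ν_k`. Marginals determine the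
law of a solution by the Markov property.

(ii) Put `Y_l = α_l⁻¹ η⁰_{l-1}`. By (E4) at `k = 0`, `Y_l⁻¹ H → H` almost surely, so any right
`H`-invariant continuous function of `Y_l` tends to its value at `1`. By (E3) the expectation of
`f(Y_l)` does not change when `f` is averaged over `H`.
-/

open scoped ENNReal BoundedContinuousFunction

namespace StochEq

section Convolution

variable {G : Type*} [Group G] [TopologicalSpace G] [IsTopologicalGroup G]
  [SecondCountableTopology G] [MeasurableSpace G] [BorelSpace G]

theorem continuous_mconv : Continuous (Y := ProbabilityMeasure G)
    fun p : ProbabilityMeasure G × ProbabilityMeasure G =>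
      ⟨(p.1 : Measure G) ∗ₘ p.2, inferInstance⟩ :=
  (ProbabilityMeasure.continuous_map continuous_mul).comp ProbabilityMeasure.continuous_prod

theorem exists_forall_mconv_eq_of_tendsto [CompactSpace G] [T2Space G] {ι κ : Type*}
    {L : Filter ι} [L.NeBot] {ν : κ → ι → ProbabilityMeasure G} {ν' θ : κ → ProbabilityMeasure G}
    {ρ : ι → ProbabilityMeasure G} (hν : ∀ k, Tendsto (ν k) L (𝓝 (ν' k)))
    (hθ : ∀ k, ∀ᶠ i in L, (ν k i : Measure G) ∗ₘ ρ i = θ k) :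
    ∃ V : ProbabilityMeasure G, ∀ k, (ν' k : Measure G) ∗ₘ V = θ k := by
  let U := Ultrafilter.of L
  have hU : (U : Filter ι) ≤ L := Ultrafilter.of_le L
  obtain ⟨V, -, hV⟩ := isCompact_univ.ultrafilter_le_nhds (U.map ρ) (by simp)
  refine ⟨V, fun k => ?_⟩
  have hρ : Tendsto ρ U (𝓝 V) := hV
  have hlim := (continuous_mconv.tendsto (ν' k, V)).comp
    (((hν k).mono_left hU).prodMk_nhds hρ)
  have hconst := hlim.congr' (f₂ := fun _ => θ k) <| by
    filter_upwards [hU (hθ k)] with i hi using Subtype.ext hi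
  exact congrArg ProbabilityMeasure.toMeasure (tendsto_nhds_unique hconst tendsto_const_nhds)

theorem integral_mconv_eq_integral_integral [CompactSpace G] (ν ρ : Measure G)
    [IsFiniteMeasure ν] [IsFiniteMeasure ρ] {f : G → ℝ} (hf : Continuous f) :
    ∫ x, f x ∂(ν ∗ₘ ρ) = ∫ w, ∫ x, f (x * w) ∂ν ∂ρ := by
  have hint : Integrable (fun p : G × G => f (p.1 * p.2)) (ν.prod ρ) :=
    (hf.comp continuous_mul).integrable_of_hasCompactSupport (.of_compactSpace _)
  rw [Measure.mconv, integral_map (by fun_prop) hf.aestronglyMeasurable,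
    integral_prod_symm _ hint]

end Convolution

theorem map_mul_right_mconv_map_inv_mul_left {G : Type*} [Group G] [MeasurableSpace G]
    [MeasurableMul₂ G] (ν ρ : Measure G) [SFinite ν] [SFinite ρ] (a : G) :
    ν.map (· * a) ∗ₘ ρ.map (a⁻¹ * ·) = ν ∗ₘ ρ := by
  rw [← Measure.mconv_dirac, ← Measure.dirac_mconv, Measure.mconv_assoc,
    ← Measure.mconv_assoc (Measure.dirac a), Measure.dirac_mconv_dirac, mul_inv_cancel,
    Measure.dirac_one_mconv]

section Harmonic

theorem ae_eq_of_integral_sq_eq_integral_mul {X : Type*} [MeasurableSpace X] {m : Measure X}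
    {f g : X → ℝ} (hf : MemLp f 2 m) (hg : MemLp g 2 m)
    (hff : ∫ x, f x ^ 2 ∂m = ∫ x, f x * g x ∂m) (hgg : ∫ x, g x ^ 2 ∂m = ∫ x, f x * g x ∂m) :
    f =ᵐ[m] g := by
  have hfg : Integrable (fun x => f x * g x) m := hf.integrable_mul hg
  have hzero : ∫ x, (f x - g x) ^ 2 ∂m = 0 := by
    calc ∫ x, (f x - g x) ^ 2 ∂m
        = ∫ x, ((f x ^ 2 - f x * g x) + (g x ^ 2 - f x * g x)) ∂m := by
          congr 1 with x; ring
      _ = (∫ x, f x ^ 2 ∂m - ∫ x, f x * g x ∂m)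
          + (∫ x, g x ^ 2 ∂m - ∫ x, f x * g x ∂m) := by
          rw [← integral_sub hf.integrable_sq hfg, ← integral_sub hg.integrable_sq hfg]
          exact integral_add (hf.integrable_sq.sub hfg) (hg.integrable_sq.sub hfg)
      _ = 0 := by rw [hff, hgg, sub_self, add_zero]
  replace hzero := (integral_eq_zero_iff_of_nonneg (fun x => sq_nonneg (f x - g x))
    (hf.sub hg).integrable_sq).1 hzero
  filter_upwards [hzero] with x hx
  exact sub_eq_zero.1 (pow_eq_zero_iff two_ne_zero |>.1 hx)

variable {G : Type*} [Group G] [MeasurableSpace G]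

/-- `F` is harmonic for the random walk `g ↦ w g` with step law `W`. The Bochner integral is `0`
when it diverges, so this is meant for functions `F` with integrable translates. -/
def IsHarmonic (W : Measure G) (F : G → ℝ) : Prop :=
  ∀ g, F g = ∫ w, F (w * g) ∂W

variable [TopologicalSpace G] [IsTopologicalGroup G] [CompactSpace G]
  [SecondCountableTopology G] [BorelSpace G]

/- In `L²(W ⊗ Haar)`, the functions `F (w g)` and `F g` have the same norm by invariance of the
Haar measure, and harmonicity makes their inner product equal to the square of this norm. -/
theorem IsHarmonic.ae_prod_haar_mul_eq {W : Measure G} [IsProbabilityMeasure W] {F : G → ℝ}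
    (hF : IsHarmonic W F) (hcont : Continuous F) :
    (fun p : G × G => F (p.1 * p.2)) =ᵐ[W.prod Measure.haar] fun p => F p.2 := by
  have hcompact {f : G × G → ℝ} : HasCompactSupport f := .of_compactSpace f
  have hsnd : ∫ p : G × G, F p.2 ^ 2 ∂(W.prod Measure.haar) = ∫ g, F g ^ 2 ∂Measure.haar := by
    rw [integral_fun_snd (fun g => F g ^ 2)]
    simp
  have hmul : ∫ p : G × G, F (p.1 * p.2) ^ 2 ∂(W.prod Measure.haar)
      = ∫ g, F g ^ 2 ∂Measure.haar := by
    rw [integral_prod _ (Continuous.integrable_of_hasCompactSupport (by fun_prop) hcompact)]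
    simp [integral_mul_left_eq_self (fun g => F g ^ 2)]
  have hinner : ∫ p : G × G, F (p.1 * p.2) * F p.2 ∂(W.prod Measure.haar)
      = ∫ g, F g ^ 2 ∂Measure.haar := by
    rw [integral_prod_symm _
      (Continuous.integrable_of_hasCompactSupport (by fun_prop) hcompact)]
    simp only [integral_mul_const, ← hF _, sq]
  exact ae_eq_of_integral_sq_eq_integral_mul
    (Continuous.memLp_of_hasCompactSupport (by fun_prop) hcompact)
    (Continuous.memLp_of_hasCompactSupport (by fun_prop) hcompact)
    (hmul.trans hinner.symm) (hsnd.trans hinner.symm)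

theorem IsHarmonic.ae_forall_mul_eq {W : Measure G} [IsProbabilityMeasure W] {F : G → ℝ}
    (hF : IsHarmonic W F) (hcont : Continuous F) : ∀ᵐ w ∂W, ∀ g, F (w * g) = F g := by
  filter_upwards [Measure.ae_ae_of_ae_prod (hF.ae_prod_haar_mul_eq hcont)] with w hw
  exact congrFun ((Continuous.ae_eq_iff_eq Measure.haar (by fun_prop) hcont).1 hw)

theorem isHarmonic_integral_mul_right {ν W : Measure G} [IsFiniteMeasure ν] [IsFiniteMeasure W]
    (hW : ν ∗ₘ W = ν) {f : G → ℝ} (hf : Continuous f) :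
    IsHarmonic W fun g => ∫ x, f (x * g) ∂ν := fun g => by
  calc ∫ x, f (x * g) ∂ν = ∫ x, f (x * g) ∂(ν ∗ₘ W) := by rw [hW]
    _ = ∫ w, ∫ x, f (x * w * g) ∂ν ∂W :=
        integral_mconv_eq_integral_integral ν W (f := fun x => f (x * g)) (by fun_prop)
    _ = ∫ w, ∫ x, f (x * (w * g)) ∂ν ∂W := by simp only [mul_assoc]

theorem mconv_eq_self_of_absolutelyContinuous {ν W V : Measure G} [IsFiniteMeasure ν]
    [IsProbabilityMeasure W] [IsProbabilityMeasure V] (hW : ν ∗ₘ W = ν) (hV : V ≪ W) :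
    ν ∗ₘ V = ν := by
  refine ext_of_forall_integral_eq_of_IsFiniteMeasure fun f => ?_
  have hcont : Continuous fun g => ∫ x, f (x * g) ∂ν := by
    simpa using continuous_parametric_integral_of_continuous (μ := ν) (s := Set.univ)
      (f := fun g x => f (x * g)) (by fun_prop) isCompact_univ
  have hinv : ∀ᵐ w ∂V, ∫ x, f (x * w) ∂ν = ∫ x, f x ∂ν := by
    filter_upwards [hV.ae_le
      ((isHarmonic_integral_mul_right hW f.continuous).ae_forall_mul_eq hcont)] with w hw
    simpa using hw 1
  rw [integral_mconv_eq_integral_integral ν V f.continuous, integral_congr_ae hinv]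
  simp

theorem mconv_eq_self_of_convexCombination {ν V₁ V₂ : Measure G} [IsFiniteMeasure ν]
    [IsProbabilityMeasure V₁] [IsProbabilityMeasure V₂] {a b : ℝ≥0} (ha : a ≠ 0)
    (hab : a + b = 1) (h : a • (ν ∗ₘ V₁) + b • (ν ∗ₘ V₂) = ν) : ν ∗ₘ V₁ = ν := by
  let W : Measure G := (a : ℝ≥0∞) • V₁ + (b : ℝ≥0∞) • V₂
  have : IsProbabilityMeasure W := ⟨by
    simp only [W, Measure.add_apply, Measure.smul_apply, smul_eq_mul, measure_univ, mul_one]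
    exact_mod_cast hab⟩
  have hW : ν ∗ₘ W = ν := by
    rwa [Measure.mconv_add, Measure.mconv_smul_right, Measure.mconv_smul_right]
  have hV₁ : V₁ ≪ W :=
    (Measure.AbsolutelyContinuous.rfl.smul_right (by simpa using ha)).add_right _
  exact mconv_eq_self_of_absolutelyContinuous hW hV₁

end Harmonic

section Window

variable {X : Type*}

/-- The sequence `x_k, x_{k+1}, …, x_n, x_n, x_n, …`: the part of a path between two indices,
padded to a sequence so that all windows live in the same space. -/
def window (k n : ℕ) (x : ℕ → X) : ℕ → X :=
  fun j => x (min (k + j) n)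

variable [MeasurableSpace X]

theorem measurable_window (k n : ℕ) : Measurable (window k n : (ℕ → X) → ℕ → X) :=
  measurable_pi_lambda _ fun _ => measurable_pi_apply _

theorem eq_of_forall_map_window_eq {Q Q' : Measure (ℕ → X)} [IsFiniteMeasure Q']
    (h : ∀ n, Q.map (window 0 n) = Q'.map (window 0 n)) : Q = Q' := by
  refine IsProjectiveLimit.unique (P := fun I => Q'.map I.restrict) (fun I => ?_) fun _ => rfl
  have hrestrict : I.restrict ∘ window 0 (I.sup id) = (I.restrict : (ℕ → X) → I → X) := by
    ext x i
    have hi : (i : ℕ) ≤ I.sup id := Finset.le_sup (f := id) i.2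
    simp only [window, Function.comp_apply, Finset.restrict, zero_add, min_eq_left hi]
  change Q.map I.restrict = Q'.map I.restrict
  rw [← hrestrict, ← Measure.map_map (by fun_prop) (measurable_window _ _), h,
    Measure.map_map (by fun_prop) (measurable_window _ _)]

/-- The recursion `η_k = ξ_k η_{k-1}` on paths: prepends to the path `p.2` the product of the
noise `p.1` and the first term of `p.2`. -/
def consMul [Mul X] (p : X × (ℕ → X)) : ℕ → X
  | 0 => p.1 * p.2 0
  | j + 1 => p.2 j

theorem measurable_consMul [Mul X] [MeasurableMul₂ X] :
    Measurable (consMul : X × (ℕ → X) → ℕ → X) :=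
  measurable_pi_lambda _ fun j => by cases j <;> simp only [consMul] <;> fun_prop

end Window

section Solution

theorem measurable_pastField {G Ω : Type*} [MeasurableSpace G] (η : ℕ → Ω → G) {k m : ℕ}
    (h : k ≤ m) : Measurable[pastField η k] (η m) :=
  measurable_iff_comap_le.2 (le_iSup₂_of_le m h le_rfl)

theorem noiseProd_of_lt {G Ω : Type*} [Group G] (ξ : ℕ → Ω → G) {k l : ℕ} (h : l < k) :
    noiseProd ξ k l = fun _ => 1 := by
  ext ω
  simp [noiseProd, List.Ico.eq_nil_of_le (Nat.succ_le_of_lt h)]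

theorem noiseProd_of_le {G Ω : Type*} [Group G] (ξ : ℕ → Ω → G) {k l : ℕ} (h : k ≤ l) :
    noiseProd ξ k l = ξ k * noiseProd ξ (k + 1) l := by
  ext ω
  simp [noiseProd, List.Ico.eq_cons (Nat.lt_succ_of_le h)]

theorem measurable_noiseProd {G Ω : Type*} [Group G] [MeasurableSpace G] [MeasurableMul₂ G]
    [MeasurableSpace Ω] {ξ : ℕ → Ω → G} (hξ : ∀ k, Measurable (ξ k)) (k l : ℕ) :
    Measurable (noiseProd ξ k l) := by
  have hprod := List.measurable_fun_prod ((List.Ico k (l + 1)).map ξ) fun f hf => by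
    obtain ⟨i, -, rfl⟩ := List.mem_map.1 hf
    exact hξ i
  simpa only [List.map_map] using! hprod

theorem map_eval_pathLaw {G Ω : Type*} [MeasurableSpace G] [MeasurableSpace Ω] (P : Measure Ω)
    {η : ℕ → Ω → G} (hη : ∀ k, Measurable (η k)) (k : ℕ) :
    (pathLaw P η).map (fun x => x k) = P.map (η k) :=
  Measure.map_map (measurable_pi_apply k) (measurable_pi_lambda _ hη)

variable {G : Type*} [Group G] [MeasurableSpace G]
  {Ω : Type*} [MeasurableSpace Ω] {P : Measure Ω}
  {Ω' : Type*} [MeasurableSpace Ω'] {P' : Measure Ω'}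
  {μ : ℕ → ProbabilityMeasure G} {η ξ : ℕ → Ω → G} {η' ξ' : ℕ → Ω' → G}

namespace IsSolution

theorem indepFun_of_measurable {β : Type*} [MeasurableSpace β] (h : IsSolution P μ η ξ) (k : ℕ)
    {Y : Ω → β} (hY : Measurable[pastField η (k + 1)] Y) : IndepFun (ξ k) Y P :=
  (IndepFun_iff_Indep _ _ _).2 (indep_of_indep_of_le_right (h.indep k) hY.comap_le)

theorem pastField_le (h : IsSolution P μ η ξ) (k : ℕ) :
    pastField η k ≤ (inferInstance : MeasurableSpace Ω) :=
  iSup₂_le fun m _ => (h.measurable_eta m).comap_le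

theorem ae_noiseProd_mul (h : IsSolution P μ η ξ) {k l : ℕ} (hkl : k ≤ l + 1) :
    ∀ᵐ ω ∂P, noiseProd ξ k l ω * η (l + 1) ω = η k ω := by
  induction hkl using Nat.decreasingInduction with
  | self => simp [noiseProd_of_lt ξ (Nat.lt_succ_self l)]
  | of_succ k hk ih =>
    filter_upwards [ih, h.equation k] with ω hprod heq
    rw [noiseProd_of_le ξ (Nat.le_of_lt_succ hk), Pi.mul_apply, mul_assoc, hprod, heq]

theorem map_window_self (h : IsSolution P μ η ξ) (n : ℕ) :
    (pathLaw P η).map (window n n) = (P.map (η n)).map (Function.const ℕ) := by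
  have hconst : (window n n : (ℕ → G) → ℕ → G) = Function.const ℕ ∘ fun x => x n := by
    ext x j
    simp [window]
  have hmeas : Measurable (Function.const ℕ : G → ℕ → G) :=
    measurable_pi_lambda _ fun _ => measurable_id
  rw [hconst, ← Measure.map_map hmeas (measurable_pi_apply n),
    map_eval_pathLaw P h.measurable_eta]

variable [MeasurableMul₂ G] [IsProbabilityMeasure P] [IsProbabilityMeasure P']

theorem map_noiseProd [MeasurableInv G] (h : IsSolution P μ η ξ) {k l : ℕ} (hkl : k ≤ l) :
    P.map (noiseProd ξ k l) = (μ k : Measure G) ∗ₘ P.map (noiseProd ξ (k + 1) l) := by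
  have hpast : Measurable[pastField η (k + 1)] fun ω => η (k + 1) ω * (η (l + 1) ω)⁻¹ :=
    Measurable.mul (measurable_pastField η le_rfl)
      (Measurable.inv (measurable_pastField η (Nat.succ_le_succ hkl)))
  have hquot : (fun ω => η (k + 1) ω * (η (l + 1) ω)⁻¹) =ᵐ[P] noiseProd ξ (k + 1) l := by
    filter_upwards [h.ae_noiseProd_mul (Nat.succ_le_succ hkl)] with ω hω
    rw [← hω, mul_inv_cancel_right]
  have hind : IndepFun (ξ k) (noiseProd ξ (k + 1) l) P :=
    (h.indepFun_of_measurable k hpast).congr (ae_eq_refl _) hquot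
  rw [noiseProd_of_le ξ hkl, hind.map_mul_eq_map_mconv_map (h.measurable_xi k)
    (measurable_noiseProd h.measurable_xi _ _), h.noise_law k]

theorem map_eta (h : IsSolution P μ η ξ) (k : ℕ) :
    P.map (η k) = (μ k : Measure G) ∗ₘ P.map (η (k + 1)) := by
  have hind := h.indepFun_of_measurable k (measurable_pastField η le_rfl)
  rw [← h.noise_law k,
    ← hind.map_mul_eq_map_mconv_map (h.measurable_xi k) (h.measurable_eta (k + 1))]
  exact Measure.map_congr (h.equation k)

theorem map_eta_eq_map_noiseProd_mconv [MeasurableInv G] (h : IsSolution P μ η ξ)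
    (h' : IsSolution P' μ η' ξ') {k l : ℕ} (hkl : k ≤ l + 1) :
    P'.map (η' k) = P.map (noiseProd ξ k l) ∗ₘ P'.map (η' (l + 1)) := by
  induction hkl using Nat.decreasingInduction with
  | self => simp [noiseProd_of_lt ξ (Nat.lt_succ_self l)]
  | of_succ k hk ih =>
    rw [h'.map_eta, ih, h.map_noiseProd (Nat.le_of_lt_succ hk), Measure.mconv_assoc]

/- Markov property: `ξ_k` is independent of the window that starts one step earlier. -/
theorem map_window (h : IsSolution P μ η ξ) {k n : ℕ} (hkn : k < n) :
    (pathLaw P η).map (window k n)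
      = ((μ k : Measure G).prod ((pathLaw P η).map (window (k + 1) n))).map consMul := by
  have hη : Measurable fun ω j => η j ω := measurable_pi_lambda _ h.measurable_eta
  have hpast : Measurable[pastField η (k + 1)] fun ω => window (k + 1) n fun j => η j ω :=
    @measurable_pi_lambda _ _ _ (pastField η (k + 1)) _ _ fun j => measurable_pastField η (by omega)
  have hwindow := hpast.mono (h.pastField_le _) le_rfl
  have hprod := (indepFun_iff_map_prod_eq_prod_map_map (h.measurable_xi k).aemeasurable
    hwindow.aemeasurable).1 (h.indepFun_of_measurable k hpast)
  have hcons : (fun ω => window k n fun j => η j ω)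
      =ᵐ[P] fun ω => consMul (ξ k ω, window (k + 1) n fun j => η j ω) := by
    filter_upwards [h.equation k] with ω hω
    funext j
    cases j with
    | zero => simpa [consMul, window, hkn.le, Nat.succ_le_of_lt hkn] using hω
    | succ j => simp only [consMul, window, add_assoc, add_comm 1 j]
  rw [pathLaw, Measure.map_map (measurable_window _ _) hη,
    Measure.map_map (measurable_window _ _) hη, ← h.noise_law k]
  exact (Measure.map_congr hcons).trans <|
    (Measure.map_map measurable_consMul ((h.measurable_xi k).prodMk hwindow)).symm.trans <|
      congrArg _ hprod

theorem pathLaw_eq_of_map_eta_eq (h : IsSolution P μ η ξ) (h' : IsSolution P' μ η' ξ')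
    (hmarginal : ∀ k, P.map (η k) = P'.map (η' k)) : pathLaw P η = pathLaw P' η' := by
  have hwindow (n k : ℕ) (hk : k ≤ n) :
      (pathLaw P η).map (window k n) = (pathLaw P' η').map (window k n) := by
    induction hk using Nat.decreasingInduction with
    | self => rw [h.map_window_self, h'.map_window_self, hmarginal]
    | of_succ k hk ih => rw [h.map_window hk, h'.map_window hk, ih]
  have : IsFiniteMeasure (pathLaw P' η') := inferInstanceAs (IsFiniteMeasure (P'.map _))
  exact eq_of_forall_map_window_eq fun n => hwindow n 0 n.zero_le

end IsSolution

end Solution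

section Extremality

variable {G : Type*} [Group G] [TopologicalSpace G] [IsTopologicalGroup G] [CompactSpace G]
  [T2Space G] [SecondCountableTopology G] [MeasurableSpace G] [BorelSpace G]
  {Ω : Type*} [MeasurableSpace Ω] {P : Measure Ω} [IsProbabilityMeasure P]
  {μ : ℕ → ProbabilityMeasure G} {η ξ : ℕ → Ω → G} {α : ℕ → G}

theorem exists_map_eta_eq_mconv (h : IsSolution P μ η ξ) (h1 : CondE1 P η ξ α)
    {Ω' : Type*} [MeasurableSpace Ω'] {P' : Measure Ω'} [IsProbabilityMeasure P']
    {η' ξ' : ℕ → Ω' → G} (h' : IsSolution P' μ η' ξ') :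
    ∃ V : ProbabilityMeasure G, ∀ k, P'.map (η' k) = P.map (η k) ∗ₘ V := by
  let ρ (l : ℕ) : ProbabilityMeasure G := ⟨(P'.map (η' (l + 1))).map ((α l)⁻¹ * ·),
    have := Measure.isProbabilityMeasure_map (μ := P') (h'.measurable_eta (l + 1)).aemeasurable
    Measure.isProbabilityMeasure_map (by fun_prop)⟩
  let θ (k : ℕ) : ProbabilityMeasure G :=
    ⟨P'.map (η' k), Measure.isProbabilityMeasure_map (h'.measurable_eta k).aemeasurable⟩
  obtain ⟨V, hV⟩ := exists_forall_mconv_eq_of_tendsto (ρ := ρ) (θ := θ) (fun k => (h1 k).tendsto)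
    fun k => by
      filter_upwards [eventually_ge_atTop k] with l hl
      have hshift : P.map (fun ω => noiseProd ξ k l ω * α l)
          = (P.map (noiseProd ξ k l)).map (· * α l) :=
        (Measure.map_map (measurable_mul_const (α l))
          (measurable_noiseProd h.measurable_xi k l)).symm
      simp only [ρ, θ, ProbabilityMeasure.coe_mk]
      rw [hshift, map_mul_right_mconv_map_inv_mul_left,
        ← h.map_eta_eq_map_noiseProd_mconv h' (Nat.le_succ_of_le hl)]
  exact ⟨V, fun k => (hV k).symm⟩

theorem isExtremal_of_condE1 (h : IsSolution P μ η ξ) (h1 : CondE1 P η ξ α) :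
    IsExtremal P μ η := by
  refine mem_extremePoints_iff_left.2 ⟨pathLaw_mem_solutionLaws P μ η ξ h, ?_⟩
  rintro _ ⟨Ω₁, _, P₁, _, η₁, ξ₁, hs₁, rfl⟩ _ ⟨Ω₂, _, P₂, _, η₂, ξ₂, hs₂, rfl⟩
    ⟨a, b, ha, -, hab, hmix⟩
  obtain ⟨V₁, hV₁⟩ := exists_map_eta_eq_mconv h h1 hs₁
  obtain ⟨V₂, hV₂⟩ := exists_map_eta_eq_mconv h h1 hs₂
  refine hs₁.pathLaw_eq_of_map_eta_eq h fun k => ?_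
  have hmarginal : a • P₁.map (η₁ k) + b • P₂.map (η₂ k) = P.map (η k) := by
    simpa only [Measure.map_add _ _ (measurable_pi_apply k), Measure.map_smul,
      map_eval_pathLaw _ hs₁.measurable_eta, map_eval_pathLaw _ hs₂.measurable_eta,
      map_eval_pathLaw _ h.measurable_eta] using congrArg (Measure.map fun x => x k) hmix
  rw [hV₁, hV₂] at hmarginal
  rw [hV₁, mconv_eq_self_of_convexCombination ha.ne' hab hmarginal]

end Extremality

section HaarLimit

theorem CondE4.ae_tendsto_mk_inv {G : Type*} [Group G] [TopologicalSpace G] [IsTopologicalGroup G]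
    [MeasurableSpace G] {Ω : Type*} [MeasurableSpace Ω] {P : Measure Ω}
    {μ : ℕ → ProbabilityMeasure G} {η ξ : ℕ → Ω → G} {α : ℕ → G} {H : Subgroup G}
    (h4 : CondE4 P η ξ α H) (h : IsSolution P μ η ξ) : ∀ᵐ ω ∂P,
      Tendsto (fun l => ((((α l)⁻¹ * η (l + 1) ω)⁻¹ : G) : G ⧸ H)) atTop
        (𝓝 ((1 : G) : G ⧸ H)) := by
  filter_upwards [h4 0, ae_all_iff.2 fun l => h.ae_noiseProd_mul (Nat.zero_le (l + 1))]
    with ω hω hprod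
  have hcancel (l : ℕ) :
      ((α l)⁻¹ * η (l + 1) ω)⁻¹ = (η 0 ω)⁻¹ * (noiseProd ξ 0 l ω * α l) := by
    rw [← hprod l]
    group
  have hsmul : Tendsto (fun l => (((η 0 ω)⁻¹ * (noiseProd ξ 0 l ω * α l) : G) : G ⧸ H)) atTop
      (𝓝 (((η 0 ω)⁻¹ * η 0 ω : G) : G ⧸ H)) :=
    ((continuous_const_smul (η 0 ω)⁻¹).tendsto _).comp hω
  simpa only [hcancel, inv_mul_cancel] using hsmul

instance isHaarMeasure_normalizedHaar (K : Type*) [Group K] [TopologicalSpace K]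
    [IsTopologicalGroup K] [CompactSpace K] [MeasurableSpace K] [BorelSpace K] :
    (normalizedHaar K).IsHaarMeasure :=
  inferInstanceAs (Measure.haarMeasure _).IsHaarMeasure

variable {G : Type*} [Group G] [TopologicalSpace G] [IsTopologicalGroup G]
  {H : Subgroup G} [CompactSpace H]

theorem tendsto_of_tendsto_mk_inv {Y : Type*} [TopologicalSpace Y] {φ : G → Y}
    (hφ : Continuous φ) (hinv : ∀ g, ∀ h ∈ H, φ (g * h) = φ g) {ι : Type*} {L : Filter ι}
    {x : ι → G} (hx : Tendsto (fun i => (((x i)⁻¹ : G) : G ⧸ H)) L (𝓝 ((1 : G) : G ⧸ H))) :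
    Tendsto (fun i => φ (x i)) L (𝓝 (φ 1)) := by
  rw [(nhds_basis_opens (φ 1)).tendsto_right_iff]
  rintro t ⟨h1t, ht⟩
  have hH : (H : Set G) ⊆ φ ⁻¹' t := fun h hh => by
    simpa [Set.mem_preimage, ← hinv 1 h hh] using h1t
  obtain ⟨U, hU, hUt⟩ := compact_open_separated_mul_right
    (isCompact_iff_compactSpace.2 inferInstance) (ht.preimage hφ) hH
  have hnhds : ((↑) : G → G ⧸ H) '' U⁻¹ ∈ 𝓝 ((1 : G) : G ⧸ H) := by
    rw [QuotientGroup.nhds_eq]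
    exact image_mem_map (inv_mem_nhds_one G hU)
  filter_upwards [hx hnhds] with i ⟨u, hu, hui⟩
  have hmem : x i * u ∈ H := by simpa using H.inv_mem (QuotientGroup.eq.1 hui)
  exact hUt ⟨x i * u, hmem, u⁻¹, hu, mul_inv_cancel_right _ _⟩

variable [MeasurableSpace G] [BorelSpace G]

/-- The average `g ↦ ∫_H f (g x) dx` of `f` over the left cosets of the compact subgroup `H`. -/
noncomputable def cosetAverage (H : Subgroup G) [CompactSpace H] (f : G → ℝ) (g : G) : ℝ :=
  ∫ x : H, f (g * x) ∂normalizedHaar H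

theorem cosetAverage_one {f : G → ℝ} (hf : Continuous f) :
    cosetAverage H f 1 = ∫ g, f g ∂(normalizedHaar H).map ((↑) : H → G) := by
  rw [integral_map continuous_subtype_val.aemeasurable hf.aestronglyMeasurable]
  simp only [cosetAverage, one_mul]

theorem cosetAverage_mul_of_mem (f : G → ℝ) (g : G) {h : G} (hh : h ∈ H) :
    cosetAverage H f (g * h) = cosetAverage H f g := by
  simpa [cosetAverage, mul_assoc] using
    integral_mul_left_eq_self (μ := normalizedHaar H) (fun x : H => f (g * x)) ⟨h, hh⟩

theorem norm_cosetAverage_le (f : G →ᵇ ℝ) (g : G) : ‖cosetAverage H f g‖ ≤ ‖f‖ := by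
  simpa using! norm_integral_le_of_norm_le_const (μ := normalizedHaar H)
    (ae_of_all _ fun x : H => f.norm_coe_le_norm (g * x))

theorem continuous_cosetAverage [FirstCountableTopology G] (f : G →ᵇ ℝ) :
    Continuous (cosetAverage H f) :=
  continuous_of_dominated (bound := fun _ => ‖f‖)
    (fun g => (f.continuous.comp (by fun_prop)).aestronglyMeasurable)
    (fun _ => ae_of_all _ fun _ => f.norm_coe_le_norm _) (integrable_const _)
    (ae_of_all _ fun x => f.continuous.comp (by fun_prop))

variable [SecondCountableTopology G]

theorem integral_cosetAverage_of_map_mul_right_eq {ν : Measure G} [IsFiniteMeasure ν]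
    (hν : ∀ h ∈ H, ν.map (· * h) = ν) (f : G →ᵇ ℝ) :
    ∫ g, cosetAverage H f g ∂ν = ∫ g, f g ∂ν := by
  have hmul : Measurable fun p : G × H => p.1 * p.2 :=
    measurable_fst.mul (measurable_subtype_coe.comp measurable_snd)
  have hint : Integrable (fun p : G × H => f (p.1 * p.2)) (ν.prod (normalizedHaar H)) :=
    .of_bound (f.continuous.measurable.comp hmul).aestronglyMeasurable ‖f‖
      (ae_of_all _ fun _ => f.norm_coe_le_norm _)
  have hshift (x : H) : ∫ g, f (g * x) ∂ν = ∫ g, f g ∂ν := by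
    conv_rhs => rw [← hν x x.2]
    exact (integral_map (by fun_prop) f.continuous.aestronglyMeasurable).symm
  simp only [cosetAverage]
  rw [integral_integral_swap hint]
  simp only [hshift, integral_const, probReal_univ, one_smul]

variable {Ω : Type*} [MeasurableSpace Ω] {P : Measure Ω} [IsProbabilityMeasure P]

theorem tendstoInDistribution_normalizedHaar {ι : Type*} {L : Filter ι} [L.IsCountablyGenerated]
    {Y : ι → Ω → G} (hY : ∀ i, Measurable (Y i))
    (hinv : ∀ i, ∀ h ∈ H, (P.map (Y i)).map (· * h) = P.map (Y i))
    (hlim : ∀ᵐ ω ∂P, Tendsto (fun i => (((Y i ω)⁻¹ : G) : G ⧸ H)) L (𝓝 ((1 : G) : G ⧸ H))) :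
    TendstoInDistribution Y L ((↑) : H → G) (fun _ => P) (normalizedHaar H) := by
  refine ⟨fun i => (hY i).aemeasurable, continuous_subtype_val.aemeasurable,
    ProbabilityMeasure.tendsto_iff_forall_integral_tendsto.2 fun f => ?_⟩
  have hcont : Continuous (cosetAverage H f) := continuous_cosetAverage f
  have haverage (i : ι) : ∫ ω, cosetAverage H f (Y i ω) ∂P = ∫ g, f g ∂P.map (Y i) := by
    rw [← integral_cosetAverage_of_map_mul_right_eq (hinv i) f,
      integral_map (hY i).aemeasurable hcont.aestronglyMeasurable]
  have hpointwise : ∀ᵐ ω ∂P,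
      Tendsto (fun i => cosetAverage H f (Y i ω)) L (𝓝 (cosetAverage H f 1)) := by
    filter_upwards [hlim] with ω hω
    exact tendsto_of_tendsto_mk_inv hcont (fun g _ => cosetAverage_mul_of_mem f g) hω
  have hdominated : Tendsto (fun i => ∫ ω, cosetAverage H f (Y i ω) ∂P) L
      (𝓝 (∫ _, cosetAverage H f 1 ∂P)) :=
    tendsto_integral_filter_of_dominated_convergence (fun _ => ‖f‖)
      (Eventually.of_forall fun i => (hcont.measurable.comp (hY i)).aestronglyMeasurable)
      (Eventually.of_forall fun _ => ae_of_all _ fun _ => norm_cosetAverage_le f _)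
      (integrable_const _) hpointwise
  simpa only [haverage, integral_const, probReal_univ, one_smul,
    cosetAverage_one f.continuous] using! hdominated

theorem condE2_of_condE3_of_condE4 {μ : ℕ → ProbabilityMeasure G} {η ξ : ℕ → Ω → G} {α : ℕ → G}
    (h : IsSolution P μ η ξ) (h3 : CondE3 P η H) (h4 : CondE4 P η ξ α H) : CondE2 P η α H := by
  refine tendstoInDistribution_normalizedHaar (fun l => (h.measurable_eta _).const_mul _)
    (fun l x hx => ?_) (h4.ae_tendsto_mk_inv h)
  have hη := h.measurable_eta (l + 1)
  calc (P.map fun ω => (α l)⁻¹ * η (l + 1) ω).map (· * x)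
      = (P.map fun ω => η (l + 1) ω * x).map ((α l)⁻¹ * ·) := by
        rw [Measure.map_map (by fun_prop) (by fun_prop),
          Measure.map_map (by fun_prop) (by fun_prop)]
        simp only [Function.comp_def, mul_assoc]
    _ = P.map fun ω => (α l)⁻¹ * η (l + 1) ω := by
        rw [h3 x hx (l + 1), Measure.map_map (by fun_prop) hη]
        rfl

end HaarLimit

end StochEq

theorem mainTheorem7_general {G : Type*} [Group G] [TopologicalSpace G] [IsTopologicalGroup G]
    [SecondCountableTopology G] [MeasurableSpace G] [BorelSpace G]
    {Ω : Type*} [MeasurableSpace Ω] (P : Measure Ω) [IsProbabilityMeasure P]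
    (μ : ℕ → ProbabilityMeasure G) (η ξ : ℕ → Ω → G) (hsol : StochEq.IsSolution P μ η ξ) :
    (∀ [CompactSpace G] [T2Space G] (α : ℕ → G), StochEq.CondE1 P η ξ α →
      StochEq.IsExtremal P μ η) ∧
    (∀ (α : ℕ → G) (H : Subgroup G) [CompactSpace H],
      StochEq.CondE3 P η H → StochEq.CondE4 P η ξ α H → StochEq.CondE2 P η α H) :=
  ⟨fun _ h1 => StochEq.isExtremal_of_condE1 hsol h1,
    fun _ _ _ h3 h4 => StochEq.condE2_of_condE3_of_condE4 hsol h3 h4⟩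

theorem mainTheorem7 {G : Type*} [Group G] [TopologicalSpace G] [IsTopologicalGroup G]
    [CompactSpace G] [T2Space G] [SecondCountableTopology G] [MeasurableSpace G] [BorelSpace G]
    {Ω : Type*} [MeasurableSpace Ω] (P : Measure Ω) [IsProbabilityMeasure P]
    (μ : ℕ → ProbabilityMeasure G) (η ξ : ℕ → Ω → G) (hsol : StochEq.IsSolution P μ η ξ) :
    (∀ α : ℕ → G, StochEq.CondE1 P η ξ α → StochEq.IsExtremal P μ η) ∧
    (∀ (α : ℕ → G) (H : Subgroup G) [CompactSpace H],
      StochEq.CondE1 P η ξ α → StochEq.CondE3 P η H → StochEq.CondE4 P η ξ α H →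
        StochEq.CondE2 P η α H) :=
  have ⟨extremal, haarLimit⟩ := mainTheorem7_general P μ η ξ hsol
  ⟨fun α h1 => extremal α h1, fun α H _ _ h3 h4 => haarLimit α H h3 h4⟩
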